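/- Let $\alpha,\beta\in\mathbb C$ with $\alpha+\beta\neq 0$, and let $$\mathfrak h=\left\{\begin{pmatrix} x_1+x_2 & x_1+x_2 & 0 & x_1\\ x_1+x_2 & x_1+x_2 & 0 & x_2\\ \alpha x_1+(\beta-1)x_2 & \beta x_1+(\alpha+1)x_2 & 0 & x_3\\ 0&0&0&0\end{pmatrix} : x_1,x_2,x_3\in\mathbb C\right\}\subset \mathfrak{gl}(4,\mathbb C).$$ Let $X_i\in\mathfrak h$ be the matrix with $x_i=1$ and $x_j=0$ for $j\ne i$. Then $X_1,X_2,X_3$ is a basis of $\mathfrak h$ and $[X_1,X_2]=X_3$, $[X_1,X_3]=[X_2,X_3]=0$, so that $\mathfrak h$ is a 3-dimensional nilpotent Lie subalgebra of $\mathfrak{gl}(4,\mathbb C)$; it is isomorphic to the Heisenberg algebra of strictly upper triangular complex $3\times 3$ matrices. The Jordan decomposition $X_1=X_{1,s}+X_{1,n}$ into commuting semisimple and nilpotent parts is $$X_{1,s}=\begin{pmatrix}1&1&0&\frac12\\1&1&0&\frac12\\ \frac{\alpha+\beta}2&\frac{\alpha+\beta}2&0&\frac{\alpha+\beta}4\\0&0&0&0\end{pmatrix},\qquad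 X_{1,n}=\begin{pmatrix}0&0&0&\frac12\\0&0&0&-\frac12\\ \frac{\alpha-\beta}2&-\frac{\alpha-\beta}2&0&-\frac{\alpha+\beta}4\\0&0&0&0\end{pmatrix},$$ and neither $X_{1,s}$ nor $X_{1,n}$ belongs to $\mathfrak h$. Moreover, $\mathfrak h$ is not algebraic: there is no subgroup $G\subset GL(4,\mathbb C)$ that is the zero set in $GL(4,\mathbb C)$ of a set of polynomials in the matrix entries and whose Lie algebra is $\mathfrak h$. Here the Lie algebra of $G$ is the set of all $X\in\mathfrak{gl}(4,\mathbb C)$ such that $dP(X)=0$ for every polynomial $P$ in the matrix entries that vanishes on $G$, where $dP$ is the differential of $P$ at the identity matrix. -/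

import Mathlib

open Matrix

attribute [local instance 100] LieRing.ofAssociativeRing

/-- A subgroup `G` of `GL(n, K)` is algebraic (Zariski closed) if it is the set of all invertible
matrices at which every member of some set `S` of polynomials in the matrix entries vanishes. -/
def IsAlgebraicSubgroup {n K : Type*} [Fintype n] [DecidableEq n] [Field K]
    (G : Subgroup (GL n K)) : Prop :=
  ∃ S : Set (MvPolynomial (n × n) K), ∀ g : GL n K,
    g ∈ G ↔ ∀ P ∈ S, MvPolynomial.eval (fun ij => (g : Matrix n n K) ij.1 ij.2) P = 0

/-- The ideal `I(G)` of all polynomials in the matrix entries that vanish on `G`. -/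
def vanishingIdealOfSubgroup {n K : Type*} [Fintype n] [DecidableEq n] [Field K]
    (G : Subgroup (GL n K)) : Ideal (MvPolynomial (n × n) K) :=
  MvPolynomial.vanishingIdeal K
    ((fun (g : GL n K) (ij : n × n) => (g : Matrix n n K) ij.1 ij.2) '' (G : Set (GL n K)))

/-- The differential `dP(X) = ∑ i j, (∂P/∂x_ij)(1) * X i j` at the identity matrix of a polynomial
`P` in the matrix entries, as a linear form in `X`. -/
noncomputable def differentialAtOne {n K : Type*} [Fintype n] [DecidableEq n] [Field K]
    (P : MvPolynomial (n × n) K) : Matrix n n K →ₗ[K] K where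
  toFun X := ∑ ij : n × n,
    MvPolynomial.eval (fun kl => (1 : Matrix n n K) kl.1 kl.2) (MvPolynomial.pderiv ij P) *
      X ij.1 ij.2
  map_add' X Y := by simp [mul_add, Finset.sum_add_distrib]
  map_smul' c X := by simp [Finset.mul_sum, mul_left_comm]

/-- (The underlying vector space of) the Lie algebra of `G`: all matrices `X` such that `dP(X) = 0`
for every `P` in the ideal `I(G)`. -/
noncomputable def lieAlgebraOfSubgroup {n K : Type*} [Fintype n] [DecidableEq n] [Field K]
    (G : Subgroup (GL n K)) : Submodule K (Matrix n n K) :=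
  ⨅ P ∈ vanishingIdealOfSubgroup G, LinearMap.ker (differentialAtOne P)

/-- A Lie subalgebra of `gl(n, K)` is algebraic if it is the Lie algebra of some algebraic subgroup
of `GL(n, K)`. -/
def IsAlgebraicLieSubalgebra {n K : Type*} [Fintype n] [DecidableEq n] [Field K]
    (L : LieSubalgebra K (Matrix n n K)) : Prop :=
  ∃ G : Subgroup (GL n K), IsAlgebraicSubgroup G ∧ L.toSubmodule = lieAlgebraOfSubgroup G

/-- The 3-dimensional complex Heisenberg algebra: strictly upper triangular `3 × 3` matrices. -/
def heisenbergAlgebra : LieSubalgebra ℂ (Matrix (Fin 3) (Fin 3) ℂ) where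
  carrier := {A | ∀ i j, j ≤ i → A i j = 0}
  add_mem' := by
    intro A B hA hB i j h
    simp [hA i j h, hB i j h]
  zero_mem' := by
    intro i j _
    rfl
  smul_mem' := by
    intro c A hA i j h
    simp [hA i j h]
  lie_mem' := by
    intro A B hA hB i j h
    have key : ∀ C D : Matrix (Fin 3) (Fin 3) ℂ, (∀ i j, j ≤ i → C i j = 0) →
        (∀ i j, j ≤ i → D i j = 0) → (C * D) i j = 0 := by
      intro C D hC hD
      rw [Matrix.mul_apply]
      refine Finset.sum_eq_zero fun k _ => ?_
      rcases le_total k i with hk | hk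
      · rw [hC i k hk, zero_mul]
      · rw [hD k j (h.trans hk), mul_zero]
    rw [Ring.lie_def, Matrix.sub_apply, key A B hA hB, key B A hB hA, sub_zero]

/-- The general element of the subspace `𝔥`. -/
def hElement (α β x₁ x₂ x₃ : ℂ) : Matrix (Fin 4) (Fin 4) ℂ :=
  !![x₁ + x₂, x₁ + x₂, 0, x₁;
     x₁ + x₂, x₁ + x₂, 0, x₂;
     α * x₁ + (β - 1) * x₂, β * x₁ + (α + 1) * x₂, 0, x₃;
     0, 0, 0, 0]

def matX₁ (α β : ℂ) : Matrix (Fin 4) (Fin 4) ℂ :=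
  !![1, 1, 0, 1;
     1, 1, 0, 0;
     α, β, 0, 0;
     0, 0, 0, 0]

def matX₂ (α β : ℂ) : Matrix (Fin 4) (Fin 4) ℂ :=
  !![1, 1, 0, 0;
     1, 1, 0, 1;
     β - 1, α + 1, 0, 0;
     0, 0, 0, 0]

def matX₃ : Matrix (Fin 4) (Fin 4) ℂ :=
  !![0, 0, 0, 0;
     0, 0, 0, 0;
     0, 0, 0, 1;
     0, 0, 0, 0]

/-- The semisimple part of `X₁`. -/
noncomputable def matX₁s (α β : ℂ) : Matrix (Fin 4) (Fin 4) ℂ :=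
  !![1, 1, 0, 1 / 2;
     1, 1, 0, 1 / 2;
     (α + β) / 2, (α + β) / 2, 0, (α + β) / 4;
     0, 0, 0, 0]

/-- The nilpotent part of `X₁`. -/
noncomputable def matX₁n (α β : ℂ) : Matrix (Fin 4) (Fin 4) ℂ :=
  !![0, 0, 0, 1 / 2;
     0, 0, 0, -1 / 2;
     (α - β) / 2, -(α - β) / 2, 0, -(α + β) / 4;
     0, 0, 0, 0]

open Polynomial in
/-- If an endomorphism `f` is the sum of a diagonalizable `s` and a locally nilpotent endomorphism
commuting with each other, then every `f`-invariant subspace is `s`-invariant. -/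
theorem Module.End.apply_mem_of_commute_of_locally_nilpotent {K V : Type*} [Field K]
    [AddCommGroup V] [Module K V] {f s : Module.End K V} (hfs : Commute f s)
    (hs : ⨆ μ, s.eigenspace μ = ⊤) (hn : ∀ v, ∃ n, ((f - s) ^ n) v = 0)
    {p : Submodule K V} (hp : ∀ v ∈ p, f v ∈ p) {v : V} (hv : v ∈ p) : s v ∈ p := by
  classical
  have hvt : v ∈ ⨆ μ, s.eigenspace μ := hs ▸ Submodule.mem_top
  obtain ⟨m, hm, rfl⟩ := (Submodule.mem_iSup_iff_exists_finsupp _ _).mp hvt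
  choose n hn using fun μ => hn (m μ)
  have hann : ∀ μ, aeval f ((X - C μ) ^ n μ) (m μ) = 0 := by
    intro μ
    have key : ∀ k, ((f - algebraMap K _ μ) ^ k) (m μ) = ((f - s) ^ k) (m μ) := by
      intro k
      induction k with
      | zero => rfl
      | succ k ih =>
        have hc : Commute s ((f - s) ^ k) := (hfs.symm.sub_right (Commute.refl s)).pow_right k
        have h1 : s (((f - s) ^ k) (m μ)) = μ • ((f - s) ^ k) (m μ) := by
          rw [← Module.End.mul_apply, hc.eq, Module.End.mul_apply,
            Module.End.mem_eigenspace_iff.mp (hm μ), map_smul]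
        rw [pow_succ', pow_succ', Module.End.mul_apply, Module.End.mul_apply, ih,
          LinearMap.sub_apply, LinearMap.sub_apply, h1, Module.algebraMap_end_apply]
    simpa [key] using hn μ
  obtain ⟨q, hq⟩ := Ideal.exists_forall_sub_mem_ideal (ι := m.support)
    (I := fun μ => Ideal.span {(X - C (μ : K) : K[X]) ^ n μ}) (by
      intro a b hab
      rw [Function.onFun, Ideal.isCoprime_span_singleton_iff]
      exact (isCoprime_X_sub_C_of_isUnit_sub (sub_ne_zero.mpr (Subtype.coe_ne_coe.mpr hab)).isUnit).pow)
    (fun μ => C (μ : K))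
  have hqv : s (m.sum fun _ x => x) = aeval f q (m.sum fun _ x => x) := by
    simp only [Finsupp.sum, map_sum]
    refine Finset.sum_congr rfl fun μ hμ => ?_
    obtain ⟨r, hr⟩ := Ideal.mem_span_singleton'.mp (hq ⟨μ, hμ⟩)
    have h0 : aeval f (q - C μ) (m μ) = 0 := by
      rw [← hr, map_mul, Module.End.mul_apply, hann, map_zero]
    rw [map_sub, LinearMap.sub_apply, aeval_C, Module.algebraMap_end_apply, sub_eq_zero] at h0
    rw [h0, Module.End.mem_eigenspace_iff.mp (hm μ)]
  rw [hqv]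
  exact aeval_apply_smul_mem_of_le_comap hv q f hp

namespace Derivation

variable {R A : Type*} [CommRing R] [CommRing A] [Algebra R A]

theorem toLinearMap_pow_add_mul_eq_zero (D : Derivation R A A) {m n : ℕ} {a b : A}
    (ha : ((D : Module.End R A) ^ m) a = 0) (hb : ((D : Module.End R A) ^ n) b = 0) :
    ((D : Module.End R A) ^ (m + n)) (a * b) = 0 := by
  obtain ⟨k, hk⟩ : ∃ k, k = m + n := ⟨_, rfl⟩
  rw [← hk]
  induction k generalizing m n a b with
  | zero =>
    obtain rfl : m = 0 := by omega
    have : a = 0 := ha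
    simp [this]
  | succ k ih =>
    rcases m with _ | m
    · have : a = 0 := ha
      simp [this]
    rcases n with _ | n
    · have : b = 0 := hb
      simp [this]
    rw [pow_succ, Module.End.mul_apply, coeFn_coe, leibniz, smul_eq_mul, smul_eq_mul, map_add,
      ih (m := m + 1) (n := n) ha ?_ (by omega), ih (m := n + 1) (n := m) hb ?_ (by omega),
      add_zero]
    · rwa [pow_succ, Module.End.mul_apply] at ha
    · rwa [pow_succ, Module.End.mul_apply] at hb

theorem mul_mem_eigenspace (D : Derivation R A A) {μ ν : R} {a b : A}
    (ha : a ∈ Module.End.eigenspace (D : Module.End R A) μ)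
    (hb : b ∈ Module.End.eigenspace (D : Module.End R A) ν) :
    a * b ∈ Module.End.eigenspace (D : Module.End R A) (μ + ν) := by
  rw [Module.End.mem_eigenspace_iff, coeFn_coe] at *
  rw [leibniz, ha, hb, smul_eq_mul, smul_eq_mul, mul_smul_comm, mul_smul_comm, mul_comm b a,
    add_smul, add_comm]

theorem mul_mem_iSup_eigenspace (D : Derivation R A A) {a b : A}
    (ha : a ∈ ⨆ μ, Module.End.eigenspace (D : Module.End R A) μ)
    (hb : b ∈ ⨆ μ, Module.End.eigenspace (D : Module.End R A) μ) :
    a * b ∈ ⨆ μ, Module.End.eigenspace (D : Module.End R A) μ := by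
  induction ha using Submodule.iSup_induction' with
  | zero => simp
  | add x y _ _ hx hy => rw [add_mul]; exact add_mem hx hy
  | mem μ x hx =>
    induction hb using Submodule.iSup_induction' with
    | zero => simp
    | add y z _ _ hy hz => rw [mul_add]; exact add_mem hy hz
    | mem ν y hy => exact Submodule.mem_iSup_of_mem _ (D.mul_mem_eigenspace hx hy)

end Derivation

section MatrixDerivation

variable {n K : Type*} [Fintype n] [Field K]

/-- The `(i, j)` entry of the product of the generic matrix with `A`, linear in `A`. -/
noncomputable def genericMulEntry (ij : n × n) : Matrix n n K →ₗ[K] MvPolynomial (n × n) K where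
  toFun A := ∑ k, A k ij.2 • MvPolynomial.X (ij.1, k)
  map_add' A B := by simp [add_smul, Finset.sum_add_distrib]
  map_smul' c A := by simp [Finset.smul_sum, mul_smul]

/-- The left-invariant derivation of the polynomials in the matrix entries attached to `A`. -/
noncomputable def matrixDerivation (A : Matrix n n K) :
    Derivation K (MvPolynomial (n × n) K) (MvPolynomial (n × n) K) :=
  MvPolynomial.mkDerivation K fun ij => genericMulEntry ij A

theorem genericMulEntry_apply (ij : n × n) (A : Matrix n n K) :
    genericMulEntry ij A = ∑ k, A k ij.2 • MvPolynomial.X (ij.1, k) := rfl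

theorem genericMulEntry_one [DecidableEq n] (ij : n × n) :
    genericMulEntry ij (1 : Matrix n n K) = MvPolynomial.X ij := by
  simp [genericMulEntry_apply, Matrix.one_apply]

theorem matrixDerivation_X (A : Matrix n n K) (ij : n × n) :
    matrixDerivation A (MvPolynomial.X ij) = genericMulEntry ij A :=
  MvPolynomial.mkDerivation_X _ _ _

theorem matrixDerivation_genericMulEntry (A B : Matrix n n K) (ij : n × n) :
    matrixDerivation A (genericMulEntry ij B) = genericMulEntry ij (A * B) := by
  rw [genericMulEntry_apply, map_sum]
  simp only [Derivation.map_smul, matrixDerivation_X, genericMulEntry_apply, Finset.smul_sum, smul_smul,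
    Matrix.mul_apply, Finset.sum_smul]
  rw [Finset.sum_comm]
  simp only [mul_comm]

theorem matrixDerivation_add (A B : Matrix n n K) :
    matrixDerivation (A + B) = matrixDerivation A + matrixDerivation B :=
  MvPolynomial.derivation_ext fun ij => by simp [matrixDerivation_X]

theorem matrixDerivation_comm {A B : Matrix n n K} (h : Commute A B) :
    Commute (matrixDerivation A : Module.End K (MvPolynomial (n × n) K)) (matrixDerivation B) := by
  have h0 : ⁅matrixDerivation A, matrixDerivation B⁆ = 0 :=
    MvPolynomial.derivation_ext fun ij => by
      simp [Derivation.commutator_apply, matrixDerivation_X, matrixDerivation_genericMulEntry,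
        h.eq]
  refine LinearMap.ext fun P => sub_eq_zero.mp ?_
  simpa [Derivation.commutator_apply] using DFunLike.congr_fun h0 P

theorem matrixDerivation_pow_X [DecidableEq n] (A : Matrix n n K) (m : ℕ) (ij : n × n) :
    ((matrixDerivation A : Module.End K (MvPolynomial (n × n) K)) ^ m) (MvPolynomial.X ij) =
      genericMulEntry ij (A ^ m) := by
  induction m with
  | zero => simp [genericMulEntry_one]
  | succ m ih =>
    rw [pow_succ', Module.End.mul_apply, ih, Derivation.coeFn_coe,
      matrixDerivation_genericMulEntry, pow_succ']

theorem matrixDerivation_locally_nilpotent [DecidableEq n] {N : Matrix n n K} (hN : IsNilpotent N)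
    (P : MvPolynomial (n × n) K) :
    ∃ m, ((matrixDerivation N : Module.End K (MvPolynomial (n × n) K)) ^ m) P = 0 := by
  induction P using MvPolynomial.induction_on with
  | C a => exact ⟨1, by simp [← MvPolynomial.algebraMap_eq]⟩
  | add p q hp hq =>
    obtain ⟨a, ha⟩ := hp
    obtain ⟨b, hb⟩ := hq
    refine ⟨a + b, ?_⟩
    rw [map_add, pow_add, Module.End.mul_apply _ _ q, hb, ← pow_add, add_comm a, pow_add,
      Module.End.mul_apply, ha, map_zero, map_zero, add_zero]
  | mul_X p ij hp =>
    obtain ⟨a, ha⟩ := hp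
    obtain ⟨b, hb⟩ := hN
    exact ⟨a + b, Derivation.toLinearMap_pow_add_mul_eq_zero _ ha
      (by rw [matrixDerivation_pow_X, hb, map_zero])⟩

theorem iSup_eigenspace_matrixDerivation [DecidableEq n] {S : Matrix n n K} {c : K} (hc : c ≠ 0)
    (hS : S * S = c • S) :
    ⨆ μ, Module.End.eigenspace
      (matrixDerivation S : Module.End K (MvPolynomial (n × n) K)) μ = ⊤ := by
  refine eq_top_iff.mpr fun P _ => ?_
  induction P using MvPolynomial.induction_on with
  | C a =>
    refine Submodule.mem_iSup_of_mem 0 ?_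
    rw [Module.End.mem_eigenspace_iff]
    simp [← MvPolynomial.algebraMap_eq]
  | add p q hp hq => exact add_mem (hp trivial) (hq trivial)
  | mul_X p ij hp =>
    refine Derivation.mul_mem_iSup_eigenspace _ (hp trivial) ?_
    rw [← genericMulEntry_one, ← sub_add_cancel (1 : Matrix n n K) (c⁻¹ • S), map_add]
    refine add_mem (Submodule.mem_iSup_of_mem 0 ?_) (Submodule.mem_iSup_of_mem c ?_)
    · rw [Module.End.mem_eigenspace_iff, Derivation.coeFn_coe, matrixDerivation_genericMulEntry,
        mul_sub, mul_one, mul_smul_comm, hS, smul_smul, inv_mul_cancel₀ hc, one_smul, sub_self,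
        map_zero, zero_smul]
    · rw [Module.End.mem_eigenspace_iff, Derivation.coeFn_coe, matrixDerivation_genericMulEntry,
        mul_smul_comm, hS, smul_comm, map_smul]

/-- Left translation by `g` of polynomials in the matrix entries: `P(x) ↦ P(g x)`. -/
noncomputable def leftTranslate (g : Matrix n n K) :
    MvPolynomial (n × n) K →ₐ[K] MvPolynomial (n × n) K :=
  MvPolynomial.aeval fun ij => ∑ k, g ij.1 k • MvPolynomial.X (k, ij.2)

theorem eval_leftTranslate (g h : Matrix n n K) (P : MvPolynomial (n × n) K) :
    MvPolynomial.eval (fun kl => h kl.1 kl.2) (leftTranslate g P) =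
      MvPolynomial.eval (fun kl => (g * h) kl.1 kl.2) P := by
  induction P using MvPolynomial.induction_on with
  | C a => simp [leftTranslate, MvPolynomial.algebraMap_eq]
  | add p q hp hq => simp [hp, hq]
  | mul_X p ij hp =>
    rw [map_mul, map_mul, map_mul, hp]
    simp [leftTranslate, MvPolynomial.smul_eval, Matrix.mul_apply]

theorem matrixDerivation_leftTranslate (g A : Matrix n n K) (P : MvPolynomial (n × n) K) :
    matrixDerivation A (leftTranslate g P) = leftTranslate g (matrixDerivation A P) := by
  induction P using MvPolynomial.induction_on with
  | C a => simp [leftTranslate, ← MvPolynomial.algebraMap_eq]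
  | add p q hp hq => simp [hp, hq]
  | mul_X p ij hp =>
    have hX : matrixDerivation A (leftTranslate g (MvPolynomial.X ij)) =
        leftTranslate g (matrixDerivation A (MvPolynomial.X ij)) := by
      simp only [leftTranslate, MvPolynomial.aeval_X, map_sum, map_smul, Derivation.map_smul, matrixDerivation_X,
        genericMulEntry_apply, Finset.smul_sum, smul_smul]
      rw [Finset.sum_comm]
      simp only [mul_comm]
    rw [map_mul, Derivation.leibniz, Derivation.leibniz, hX, hp]
    simp

theorem Derivation.sum_apply {R A M ι : Type*} [CommSemiring R] [CommSemiring A] [AddCommMonoid M]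
    [Algebra R A] [Module A M] [Module R M] (s : Finset ι) (D : ι → Derivation R A M) (a : A) :
    (∑ i ∈ s, D i) a = ∑ i ∈ s, D i a := by
  rw [← Derivation.coeFnAddMonoidHom_apply, map_sum, Finset.sum_apply]
  rfl

variable [DecidableEq n]

theorem differentialAtOne_apply (P : MvPolynomial (n × n) K) (A : Matrix n n K) :
    differentialAtOne P A =
      MvPolynomial.eval (fun kl => (1 : Matrix n n K) kl.1 kl.2) (matrixDerivation A P) := by
  have h : matrixDerivation A = ∑ ij : n × n, genericMulEntry ij A • MvPolynomial.pderiv ij := by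
    refine MvPolynomial.derivation_ext fun ij => ?_
    rw [matrixDerivation_X, Derivation.sum_apply, Finset.sum_eq_single ij]
    · simp
    · intro b _ hb
      simp [MvPolynomial.pderiv_X_of_ne hb.symm]
    · simp
  have h1 : ∀ ij : n × n, MvPolynomial.eval (fun kl => (1 : Matrix n n K) kl.1 kl.2)
      (genericMulEntry ij A) = A ij.1 ij.2 := by
    intro ij
    simp [genericMulEntry_apply, MvPolynomial.smul_eval, Matrix.one_apply]
  rw [h, Derivation.sum_apply, map_sum]
  simp [differentialAtOne, h1, mul_comm]

theorem mem_vanishingIdealOfSubgroup {G : Subgroup (GL n K)} {P : MvPolynomial (n × n) K} :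
    P ∈ vanishingIdealOfSubgroup G ↔
      ∀ g ∈ G, MvPolynomial.eval (fun kl => (g : Matrix n n K) kl.1 kl.2) P = 0 := by
  simp [vanishingIdealOfSubgroup, MvPolynomial.mem_vanishingIdeal_iff, MvPolynomial.aeval_eq_eval]

theorem mem_lieAlgebraOfSubgroup {G : Subgroup (GL n K)} {A : Matrix n n K} :
    A ∈ lieAlgebraOfSubgroup G ↔ ∀ P ∈ vanishingIdealOfSubgroup G, differentialAtOne P A = 0 := by
  simp [lieAlgebraOfSubgroup, Submodule.mem_iInf]

/-- A matrix lies in the Lie algebra of `G` if and only if its left-invariant derivation preserves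
the vanishing ideal of `G`. -/
theorem mem_lieAlgebraOfSubgroup_iff_matrixDerivation {G : Subgroup (GL n K)} {A : Matrix n n K} :
    A ∈ lieAlgebraOfSubgroup G ↔
      ∀ P ∈ vanishingIdealOfSubgroup G, matrixDerivation A P ∈ vanishingIdealOfSubgroup G := by
  rw [mem_lieAlgebraOfSubgroup]
  constructor
  · intro h P hP
    rw [mem_vanishingIdealOfSubgroup] at hP ⊢
    intro g hg
    have := h (leftTranslate g P) (mem_vanishingIdealOfSubgroup.mpr fun k hk => by
      rw [eval_leftTranslate]
      exact hP (g * k) (mul_mem hg hk))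
    rwa [differentialAtOne_apply, matrixDerivation_leftTranslate, eval_leftTranslate, mul_one]
      at this
  · intro h P hP
    rw [differentialAtOne_apply]
    exact mem_vanishingIdealOfSubgroup.mp (h P hP) 1 (one_mem G)

/-- If the Lie algebra of `G` contains `S + N` with `N` nilpotent, commuting with `S`, and `S` a
nonzero multiple of an idempotent, then it contains `S`. -/
theorem mem_lieAlgebraOfSubgroup_of_add_nilpotent {G : Subgroup (GL n K)} {S N : Matrix n n K}
    {c : K} (hc : c ≠ 0) (hS : S * S = c • S) (hN : IsNilpotent N) (hSN : Commute S N)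
    (h : S + N ∈ lieAlgebraOfSubgroup G) : S ∈ lieAlgebraOfSubgroup G := by
  rw [mem_lieAlgebraOfSubgroup_iff_matrixDerivation] at h ⊢
  intro P hP
  refine Module.End.apply_mem_of_commute_of_locally_nilpotent
    (f := (matrixDerivation (S + N) : Module.End K (MvPolynomial (n × n) K)))
    (s := (matrixDerivation S : Module.End K (MvPolynomial (n × n) K)))
    (p := (vanishingIdealOfSubgroup G).restrictScalars K)
    (matrixDerivation_comm ((Commute.refl S).add_left hSN.symm))
    (iSup_eigenspace_matrixDerivation hc hS) (fun Q => ?_) h hP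
  have hsub : (matrixDerivation (S + N) : Module.End K (MvPolynomial (n × n) K)) -
      matrixDerivation S = matrixDerivation N := by
    rw [matrixDerivation_add]
    ext1
    simp
  rw [hsub]
  exact matrixDerivation_locally_nilpotent hN Q

end MatrixDerivation

theorem hElement_lie (α β x₁ x₂ x₃ y₁ y₂ y₃ : ℂ) :
    ⁅hElement α β x₁ x₂ x₃, hElement α β y₁ y₂ y₃⁆ =
      hElement α β 0 0 (x₁ * y₂ - x₂ * y₁) := by
  rw [Ring.lie_def]
  ext i j
  fin_cases i <;> fin_cases j <;>
    simp [hElement] <;> ring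

theorem hElement_zero (α β : ℂ) : hElement α β 0 0 0 = 0 := by
  ext i j
  fin_cases i <;> fin_cases j <;> simp [hElement]

/-- The elements of `𝔥` as a linear function of their three coordinates. -/
def hElementLinear (α β : ℂ) : (Fin 3 → ℂ) →ₗ[ℂ] Matrix (Fin 4) (Fin 4) ℂ where
  toFun x := hElement α β (x 0) (x 1) (x 2)
  map_add' x y := by
    ext i j
    fin_cases i <;> fin_cases j <;> simp [hElement] <;> ring
  map_smul' c x := by
    ext i j
    fin_cases i <;> fin_cases j <;> simp [hElement] <;> ring

theorem hElementLinear_injective (α β : ℂ) : Function.Injective (hElementLinear α β) := by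
  intro x y h
  funext k
  fin_cases k
  · simpa [hElementLinear, hElement] using congrFun (congrFun h 0) 3
  · simpa [hElementLinear, hElement] using congrFun (congrFun h 1) 3
  · simpa [hElementLinear, hElement] using congrFun (congrFun h 2) 3

/-- The Lie algebra `𝔥`. -/
def hSubalgebra (α β : ℂ) : LieSubalgebra ℂ (Matrix (Fin 4) (Fin 4) ℂ) where
  toSubmodule := LinearMap.range (hElementLinear α β)
  lie_mem' := by
    rintro _ _ ⟨x, rfl⟩ ⟨y, rfl⟩
    exact ⟨![0, 0, x 0 * y 1 - x 1 * y 0], (hElement_lie _ _ _ _ _ _ _ _).symm⟩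

theorem mem_hSubalgebra {α β : ℂ} {A : Matrix (Fin 4) (Fin 4) ℂ} :
    A ∈ hSubalgebra α β ↔ ∃ x₁ x₂ x₃ : ℂ, A = hElement α β x₁ x₂ x₃ := by
  constructor
  · rintro ⟨x, rfl⟩
    exact ⟨x 0, x 1, x 2, rfl⟩
  · rintro ⟨x₁, x₂, x₃, rfl⟩
    exact ⟨![x₁, x₂, x₃], rfl⟩

theorem matX₁_eq (α β : ℂ) : matX₁ α β = hElement α β 1 0 0 := by
  simp [matX₁, hElement]

theorem matX₂_eq (α β : ℂ) : matX₂ α β = hElement α β 0 1 0 := by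
  simp [matX₂, hElement]

theorem matX₃_eq (α β : ℂ) : matX₃ = hElement α β 0 0 1 := by
  simp [matX₃, hElement]

theorem hSubalgebra_toSubmodule (α β : ℂ) :
    (hSubalgebra α β).toSubmodule = Submodule.span ℂ {matX₁ α β, matX₂ α β, matX₃} := by
  apply le_antisymm
  · rintro _ ⟨x, rfl⟩
    have h : hElementLinear α β x =
        x 0 • matX₁ α β + x 1 • matX₂ α β + x 2 • matX₃ := by
      ext i j
      fin_cases i <;> fin_cases j <;>
        simp [hElementLinear, hElement, matX₁, matX₂, matX₃] <;> ring
    rw [h]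
    refine add_mem (add_mem ?_ ?_) ?_ <;>
      exact Submodule.smul_mem _ _ (Submodule.subset_span (by simp))
  · rw [Submodule.span_le]
    rintro A (rfl | rfl | rfl)
    · exact mem_hSubalgebra.mpr ⟨1, 0, 0, matX₁_eq α β⟩
    · exact mem_hSubalgebra.mpr ⟨0, 1, 0, matX₂_eq α β⟩
    · exact mem_hSubalgebra.mpr ⟨0, 0, 1, matX₃_eq α β⟩

theorem finrank_hSubalgebra (α β : ℂ) : Module.finrank ℂ (hSubalgebra α β) = 3 := by
  refine (LinearMap.finrank_range_of_inj (hElementLinear_injective α β)).trans ?_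
  simp

theorem isNilpotent_hSubalgebra (α β : ℂ) : LieRing.IsNilpotent (hSubalgebra α β) := by
  have : IsNoetherian ℂ (hSubalgebra α β) :=
    inferInstanceAs (IsNoetherian ℂ (LinearMap.range (hElementLinear α β)))
  rw [LieAlgebra.isNilpotent_iff_forall (R := ℂ)]
  rintro ⟨_, x, rfl⟩
  refine ⟨2, LinearMap.ext ?_⟩
  rintro ⟨_, y, rfl⟩
  rw [pow_two, Module.End.mul_apply, LieAlgebra.ad_apply, LieAlgebra.ad_apply]
  refine Subtype.ext ?_
  change ⁅hElement α β _ _ _, ⁅hElement α β _ _ _, hElement α β _ _ _⁆⁆ = 0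
  rw [hElement_lie, hElement_lie]
  simp [hElement_zero]

/-- The isomorphism of `𝔥` with the Heisenberg algebra that reads off the last column. -/
def hSubalgebraEquivHeisenberg (α β : ℂ) : hSubalgebra α β ≃ₗ⁅ℂ⁆ heisenbergAlgebra where
  toFun A := ⟨!![0, A.1 0 3, A.1 2 3; 0, 0, A.1 1 3; 0, 0, 0], by
    intro i j hij
    fin_cases i <;> fin_cases j <;> simp at hij ⊢⟩
  map_add' A B := by
    refine Subtype.ext ?_
    ext i j
    fin_cases i <;> fin_cases j <;> simp
  map_smul' c A := by
    refine Subtype.ext ?_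
    ext i j
    fin_cases i <;> fin_cases j <;> simp
  map_lie' := by
    rintro ⟨_, x, rfl⟩ ⟨_, y, rfl⟩
    refine Subtype.ext ?_
    have h : ⁅hElementLinear α β x, hElementLinear α β y⁆ = _ := hElement_lie _ _ _ _ _ _ _ _
    simp only [LieSubalgebra.coe_bracket, h]
    rw [Ring.lie_def]
    ext i j
    fin_cases i <;> fin_cases j <;>
      simp [hElement, hElementLinear]
    ring
  invFun B := ⟨hElement α β (B.1 0 1) (B.1 1 2) (B.1 0 2), mem_hSubalgebra.mpr ⟨_, _, _, rfl⟩⟩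
  left_inv := by
    rintro ⟨_, x, rfl⟩
    refine Subtype.ext ?_
    simp [hElement, hElementLinear]
  right_inv := by
    rintro ⟨B, hB⟩
    refine Subtype.ext ?_
    ext i j
    fin_cases i <;> fin_cases j <;> simp [hElement] <;> exact (hB _ _ (by decide)).symm

theorem matX₁s_add_matX₁n (α β : ℂ) : matX₁ α β = matX₁s α β + matX₁n α β := by
  ext i j
  fin_cases i <;> fin_cases j <;> simp [matX₁, matX₁s, matX₁n] <;> ring

theorem matX₁s_mul_self (α β : ℂ) : matX₁s α β * matX₁s α β = (2 : ℂ) • matX₁s α β := by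
  ext i j
  fin_cases i <;> fin_cases j <;>
    simp [matX₁s, Matrix.mul_apply, Fin.sum_univ_four] <;> ring

theorem commute_matX₁s_matX₁n (α β : ℂ) : Commute (matX₁s α β) (matX₁n α β) := by
  ext i j
  fin_cases i <;> fin_cases j <;>
    simp [matX₁s, matX₁n, Matrix.mul_apply, Fin.sum_univ_four] <;> ring

theorem isNilpotent_matX₁n (α β : ℂ) : IsNilpotent (matX₁n α β) := by
  refine ⟨3, ?_⟩
  rw [pow_succ, pow_two]
  ext i j
  fin_cases i <;> fin_cases j <;>
    simp [matX₁n, Matrix.mul_apply, Fin.sum_univ_four]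

open Polynomial in
theorem isSemisimple_matX₁s (α β : ℂ) :
    Module.End.IsSemisimple (Matrix.toLin' (matX₁s α β)) := by
  have hsep : (X * (X - C 2) : ℂ[X]).Separable := by
    refine separable_X.mul (separable_X_sub_C) ?_
    simpa using isCoprime_X_sub_C_of_isUnit_sub (a := (0 : ℂ)) (b := 2) (by simp)
  refine Module.End.isSemisimple_of_squarefree_aeval_eq_zero hsep.squarefree ?_
  rw [map_mul, map_sub, aeval_X, aeval_C, mul_sub, ← Algebra.commutes, ← Algebra.smul_def,
    Module.End.mul_eq_comp, ← Matrix.toLin'_mul, matX₁s_mul_self, map_smul, sub_self]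

theorem matX₁s_notMem_hSubalgebra (α β : ℂ) : matX₁s α β ∉ hSubalgebra α β := by
  rw [mem_hSubalgebra]
  rintro ⟨x₁, x₂, x₃, h⟩
  have h1 : 1 / 2 = x₁ := congrFun (congrFun h 0) 3
  have h2 : 1 / 2 = x₂ := congrFun (congrFun h 1) 3
  have h3 : (α + β) / 2 = α * x₁ + (β - 1) * x₂ := congrFun (congrFun h 2) 0
  rw [← h1, ← h2] at h3
  have : (1 : ℂ) = 0 := by linear_combination 2 * h3
  exact one_ne_zero this

theorem matX₁n_notMem_hSubalgebra (α β : ℂ) : matX₁n α β ∉ hSubalgebra α β := by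
  rw [mem_hSubalgebra]
  rintro ⟨x₁, x₂, x₃, h⟩
  have h1 : 1 / 2 = x₁ := congrFun (congrFun h 0) 3
  have h2 : -1 / 2 = x₂ := congrFun (congrFun h 1) 3
  have h3 : (α - β) / 2 = α * x₁ + (β - 1) * x₂ := congrFun (congrFun h 2) 0
  rw [← h1, ← h2] at h3
  have : (1 : ℂ) = 0 := by linear_combination -2 * h3
  exact one_ne_zero this

theorem not_isAlgebraicLieSubalgebra_hSubalgebra (α β : ℂ) :
    ¬ IsAlgebraicLieSubalgebra (hSubalgebra α β) := by
  rintro ⟨G, -, hG⟩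
  have hX : matX₁s α β + matX₁n α β ∈ lieAlgebraOfSubgroup G := by
    rw [← hG, ← matX₁s_add_matX₁n]
    exact mem_hSubalgebra.mpr ⟨1, 0, 0, matX₁_eq α β⟩
  have hS := mem_lieAlgebraOfSubgroup_of_add_nilpotent two_ne_zero (matX₁s_mul_self α β)
    (isNilpotent_matX₁n α β) (commute_matX₁s_matX₁n α β) hX
  rw [← hG] at hS
  exact matX₁s_notMem_hSubalgebra α β hS

theorem mainTheorem1 (α β : ℂ) (hαβ : α + β ≠ 0) :
    ∃ 𝔥 : LieSubalgebra ℂ (Matrix (Fin 4) (Fin 4) ℂ),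
      -- `𝔥` is the given subspace, with basis `X₁, X₂, X₃`
      (𝔥 : Set (Matrix (Fin 4) (Fin 4) ℂ)) =
        {A | ∃ x₁ x₂ x₃ : ℂ, A = hElement α β x₁ x₂ x₃} ∧
      𝔥.toSubmodule = Submodule.span ℂ {matX₁ α β, matX₂ α β, matX₃} ∧
      Module.finrank ℂ 𝔥 = 3 ∧
      -- bracket relations; `𝔥` is nilpotent and isomorphic to the Heisenberg algebra
      ⁅matX₁ α β, matX₂ α β⁆ = matX₃ ∧ ⁅matX₁ α β, matX₃⁆ = 0 ∧ ⁅matX₂ α β, matX₃⁆ = 0 ∧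
      LieRing.IsNilpotent 𝔥 ∧
      Nonempty (𝔥 ≃ₗ⁅ℂ⁆ heisenbergAlgebra) ∧
      -- the Jordan decomposition of `X₁`, with both parts outside `𝔥`
      matX₁ α β = matX₁s α β + matX₁n α β ∧
      Commute (matX₁s α β) (matX₁n α β) ∧
      Module.End.IsSemisimple (Matrix.toLin' (matX₁s α β)) ∧
      IsNilpotent (matX₁n α β) ∧
      matX₁s α β ∉ 𝔥 ∧ matX₁n α β ∉ 𝔥 ∧
      -- `𝔥` is not algebraic
      ¬ IsAlgebraicLieSubalgebra 𝔥 := by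
  refine ⟨hSubalgebra α β, Set.ext fun _ => mem_hSubalgebra, hSubalgebra_toSubmodule α β,
    finrank_hSubalgebra α β, ?_, ?_, ?_, isNilpotent_hSubalgebra α β,
    ⟨hSubalgebraEquivHeisenberg α β⟩, matX₁s_add_matX₁n α β, commute_matX₁s_matX₁n α β,
    isSemisimple_matX₁s α β, isNilpotent_matX₁n α β, matX₁s_notMem_hSubalgebra α β,
    matX₁n_notMem_hSubalgebra α β, not_isAlgebraicLieSubalgebra_hSubalgebra α β⟩
  · rw [matX₁_eq, matX₂_eq, matX₃_eq α β, hElement_lie]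
    simp
  · rw [matX₁_eq, matX₃_eq α β, hElement_lie]
    simp [hElement_zero]
  · rw [matX₂_eq, matX₃_eq α β, hElement_lie]
    simp [hElement_zero]
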